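/- Let $G=SU(2)$ carry the Haar measure $dg$ normalized by $\mathrm{vol}(G)=4\pi^2$. For $\theta\in\mathbb R$ put $t_\theta=\mathrm{diag}(e^{i\theta},e^{-i\theta})$, and let $\mu_\theta$ be the conjugation invariant measure of total mass $4\pi\sin^2\theta$ carried by the conjugacy class $C_\theta$ of $t_\theta$, regarded as a measure on $G$. Let $0<\beta\le\alpha<\pi$, and define $f:\mathbb R\to\mathbb R$ by $$f(\theta)=\begin{cases}4\pi^2\sin\alpha\sin\beta\sin\theta,& \alpha-\beta\le\theta\le\alpha+\beta,\\ -4\pi^2\sin\alpha\sin\beta\sin\theta,& -\alpha-\beta\le\theta\le-\alpha+\beta,\\ 0,&\text{otherwise.}\end{cases}$$ Then the convolution $\mu_\alpha\star\mu_\beta$ is absolutely continuous with respect to $dg$ and is invariant under conjugation. It has the form $h(g)\,dg$ for a nonnegative, measurable, integrable class function $h$ whose density on the torus, $$\nu(\theta)=(h\star\mu_\theta)(e)=\int_G h(x^{-1})\,d\mu_\theta(x)=4\pi\sin^2\theta\; h(t_\theta),$$ is given by $f$, read as a function on the circle $\mathbb R/2\pi\mathbb Z$: $\nu(\theta)=\sum_{k\in\mathbb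 Z}f(\theta+2\pi k)$ for every $\theta\in\mathbb R$. In particular, if $\alpha+\beta\le\pi$, then $\nu(\theta)=f(\theta)$ for all $\theta\in[-\pi,\pi]$. Moreover, for every continuous class function $\varphi:G\to\mathbb R$, $$\int_G\varphi\,d(\mu_\alpha\star\mu_\beta)=\int_{\mathbb R}\varphi(t_\theta)f(\theta)\,d\theta .$$ -/

import Mathlib

open MeasureTheory

noncomputable section

namespace SU2Conv

/-- The group `SU(2)`, with the topology induced from the space of `2 × 2` complex matrices. -/
abbrev SU2 : Type := Matrix.specialUnitaryGroup (Fin 2) ℂ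

/-- The Borel sigma-algebra of `SU(2)`. -/
instance instMeasurableSpaceSU2 : MeasurableSpace SU2 := borel SU2

instance instBorelSpaceSU2 : BorelSpace SU2 := ⟨rfl⟩

instance instIsTopologicalGroupSU2 : IsTopologicalGroup SU2 where
  continuous_mul := by
    refine Continuous.subtype_mk ?_ _
    exact (continuous_subtype_val.comp continuous_fst).mul
      (continuous_subtype_val.comp continuous_snd)
  continuous_inv := by
    refine Continuous.subtype_mk ?_ _
    exact continuous_subtype_val.star

instance instCompactSpaceSU2 : CompactSpace SU2 := by
  refine isCompact_iff_compactSpace.mp ?_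
  have hK : IsCompact (Set.pi Set.univ (fun _ : Fin 2 =>
      Set.pi Set.univ (fun _ : Fin 2 => Metric.closedBall (0 : ℂ) 1))) :=
    isCompact_univ_pi fun _ => isCompact_univ_pi fun _ => isCompact_closedBall _ _
  refine IsCompact.of_isClosed_subset (hK : IsCompact (X := Matrix (Fin 2) (Fin 2) ℂ) _) ?_ ?_
  · have : (Matrix.specialUnitaryGroup (Fin 2) ℂ : Set (Matrix (Fin 2) (Fin 2) ℂ)) =
        {A | A * star A = 1} ∩ {A | A.det = 1} := by
      ext A
      simp [Matrix.mem_specialUnitaryGroup_iff, Matrix.mem_unitaryGroup_iff]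
    rw [this]
    exact (isClosed_eq (continuous_id.mul continuous_id.star) continuous_const).inter
      (isClosed_eq continuous_id.matrix_det continuous_const)
  · intro A hA i _ j _
    have h := entry_norm_bound_of_unitary (Matrix.mem_specialUnitaryGroup_iff.mp hA).1 i j
    simpa using h

/-- The Haar measure of `SU(2)`, normalized to have total mass `4π²`. -/
def vol : Measure SU2 :=
  ENNReal.ofReal (4 * Real.pi ^ 2) • Measure.haarMeasure (⊤ : TopologicalSpace.PositiveCompacts SU2)

/-- The element `diag(e^{iθ}, e^{-iθ})` of the maximal torus of diagonal matrices. -/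
def torus (θ : ℝ) : SU2 :=
  ⟨!![Complex.exp (θ * Complex.I), 0; 0, Complex.exp (-(θ * Complex.I))], by
    rw [Matrix.mem_specialUnitaryGroup_iff, Matrix.mem_unitaryGroup_iff]
    constructor
    · ext i j
      fin_cases i <;> fin_cases j <;>
        simp [Matrix.mul_apply, Matrix.star_apply, ← Complex.exp_conj, ← Complex.exp_add]
    · simp [Matrix.det_fin_two, ← Complex.exp_add]⟩

/-- The invariant measure `μ_θ` on the conjugacy class `C_θ` of `diag(e^{iθ}, e^{-iθ})`, regarded
as a measure on `SU(2)`: the image of the Haar probability measure under the orbit map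
`g ↦ g diag(e^{iθ}, e^{-iθ}) g⁻¹`, scaled to have total mass `4π sin² θ`. -/
def classMeasure (θ : ℝ) : Measure SU2 :=
  ENNReal.ofReal (4 * Real.pi * Real.sin θ ^ 2) •
    Measure.map (fun g : SU2 => g * torus θ * g⁻¹)
      (Measure.haarMeasure (⊤ : TopologicalSpace.PositiveCompacts SU2))

/-- For a function `h` on `SU(2)`, the function `θ ↦ (h ⋆ μ_θ)(e) = ∫ h(x⁻¹) dμ_θ(x)`. When `h` is
a class function this is `4π sin² θ` times the value of `h` at `diag(e^{iθ}, e^{-iθ})`; it is the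
density on the torus, with respect to `dθ`, of the conjugation invariant measure `h • vol`. -/
def torusDensity (h : SU2 → ℝ) (θ : ℝ) : ℝ := ∫ x, h x⁻¹ ∂(classMeasure θ)

open Classical in
/-- The piecewise function of the real variable `θ` that appears in the product formula. -/
def productDensity (α β θ : ℝ) : ℝ :=
  if α - β ≤ θ ∧ θ ≤ α + β then 4 * Real.pi ^ 2 * Real.sin α * Real.sin β * Real.sin θ
  else if -α - β ≤ θ ∧ θ ≤ -α + β then -(4 * Real.pi ^ 2 * Real.sin α * Real.sin β * Real.sin θ)
  else 0

end SU2Conv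

end

namespace SU2Conv

/-! ### Coordinates, trace and conjugacy classes of `SU2`. -/

section

open Matrix ComplexConjugate

/-! Two elements of SU(2) are conjugate iff their traces agree, so a conjugation invariant measure
is determined by the law of half the trace (`eq_of_map_halfTrace_eq`). It suffices to compare that
law for μ_α ⋆ μ_β and for the candidate h dg.

For the convolution, half the trace of t_α k t_β k⁻¹ is cos(α-β) - 2 sin α sin β |k₀₀|²
(`halfTrace_torus_mul_conj_torus`), and |k₀₀|² is uniform on [0, 1] for Haar-random k
(`map_diagSq_haar`). Hence the law is 8π² sin α sin β dt on [cos(α+β), cos(α-β)]. By Weyl's formula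
(`map_halfTrace_haar`), `vol` has law 8π sin²θ dθ in the angle θ ∈ [0, π]. Since |dt| = sin θ dθ,
the quotient is h = π sin α sin β / sin θ, and 4π sin²θ · h is the stated density.

Both facts about Haar measure are proved by moments, computed by differentiating translation
invariance along one-parameter subgroups. If α + β > π, the part of f beyond π folds back onto the
circle with negative sign and cancels part of f (`four_pi_mul_sin_sq_mul_angleDensity`). -/

instance instSecondCountableTopologySU2 : SecondCountableTopology SU2 := by
  have : SecondCountableTopology (Matrix (Fin 2) (Fin 2) ℂ) :=
    inferInstanceAs (SecondCountableTopology (Fin 2 → Fin 2 → ℂ))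
  exact TopologicalSpace.Subtype.secondCountableTopology
    (Matrix.specialUnitaryGroup (Fin 2) ℂ : Set (Matrix (Fin 2) (Fin 2) ℂ))

/-- The normalized Haar measure of `SU(2)`. -/
noncomputable abbrev haar : Measure SU2 :=
  Measure.haarMeasure (⊤ : TopologicalSpace.PositiveCompacts SU2)

instance instIsProbabilityMeasureHaar : IsProbabilityMeasure haar :=
  ⟨by simpa using Measure.haarMeasure_self (K₀ := (⊤ : TopologicalSpace.PositiveCompacts SU2))⟩

instance instIsMulRightInvariantHaar : haar.IsMulRightInvariant := by
  refine ⟨fun g => ?_⟩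
  have : IsProbabilityMeasure (Measure.map (· * g) haar) :=
    Measure.isProbabilityMeasure_map (by fun_prop)
  exact Measure.isHaarMeasure_eq_of_isProbabilityMeasure _ _

lemma coe_inv (g : SU2) : (g⁻¹ : SU2).1 = star g.1 := rfl

lemma coe_mul_apply (g k : SU2) (i j : Fin 2) :
    (g * k).1 i j = g.1 i 0 * k.1 0 j + g.1 i 1 * k.1 1 j := by
  simp [Matrix.mul_apply]

lemma det_eq_one (g : SU2) : g.1 0 0 * g.1 1 1 - g.1 0 1 * g.1 1 0 = 1 := by
  have := (Matrix.mem_specialUnitaryGroup_iff.mp g.2).2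
  rwa [Matrix.det_fin_two] at this

/-- Both sides invert g, by unitarity and by determinant one. Comparing entries gives the shape (a,
-b̄; b, ā) of the elements of SU(2). -/
lemma star_eq_adjugate (g : SU2) : star g.1 = g.1.adjugate := by
  have h1 := Matrix.mem_unitaryGroup_iff'.mp (Matrix.mem_specialUnitaryGroup_iff.mp g.2).1
  have h2 := Matrix.mul_adjugate g.1
  rw [(Matrix.mem_specialUnitaryGroup_iff.mp g.2).2, one_smul] at h2
  calc star g.1 = star g.1 * (g.1 * g.1.adjugate) := by rw [h2, mul_one]
    _ = g.1.adjugate := by rw [← mul_assoc, h1, one_mul]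

lemma apply_one_one (g : SU2) : g.1 1 1 = conj (g.1 0 0) := by
  have := congrFun (congrFun (star_eq_adjugate g) 0) 0
  simpa [Matrix.adjugate_fin_two, Matrix.star_apply] using this.symm

lemma apply_zero_one (g : SU2) : g.1 0 1 = -conj (g.1 1 0) := by
  have := congrFun (congrFun (star_eq_adjugate g) 0) 1
  simp [Matrix.adjugate_fin_two, Matrix.star_apply] at this
  rw [this, neg_neg]

/-- The four real coordinates sum up to one in square. -/
lemma sum_sq (g : SU2) : (g.1 0 0).re ^ 2 + (g.1 0 0).im ^ 2 + (g.1 1 0).re ^ 2 +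
    (g.1 1 0).im ^ 2 = 1 := by
  have h := det_eq_one g
  rw [apply_one_one, apply_zero_one] at h
  have := congrArg Complex.re h
  simp at this
  linarith

/-- The element of `SU(2)` with first column `(a, b)`. -/
def ofColumn (a b : ℂ) (h : Complex.normSq a + Complex.normSq b = 1) : SU2 :=
  ⟨!![a, -conj b; b, conj a], by
    have h1 : a * conj a + b * conj b = 1 := by
      rw [Complex.mul_conj, Complex.mul_conj]; exact_mod_cast h
    rw [Matrix.mem_specialUnitaryGroup_iff, Matrix.mem_unitaryGroup_iff]
    constructor
    · ext i j
      fin_cases i <;> fin_cases j <;>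
        simp [Matrix.mul_apply, Matrix.star_apply] <;> first | linear_combination h1 | ring
    · simp [Matrix.det_fin_two]; linear_combination h1⟩

/-- Half the trace of an element of `SU(2)`. -/
def halfTrace (g : SU2) : ℝ := (g.1 0 0).re

lemma continuous_entry (i j : Fin 2) : Continuous fun g : SU2 => g.1 i j :=
  (continuous_subtype_val (p := fun A => A ∈ Matrix.specialUnitaryGroup (Fin 2) ℂ)).matrix_elem i j

lemma continuous_halfTrace : Continuous halfTrace :=
  Complex.continuous_re.comp (continuous_entry 0 0)

lemma measurable_halfTrace : Measurable halfTrace := continuous_halfTrace.measurable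

lemma two_mul_halfTrace (g : SU2) : ((2 * halfTrace g : ℝ) : ℂ) = g.1.trace := by
  rw [Matrix.trace_fin_two, apply_one_one, Complex.add_conj]; rfl

lemma halfTrace_mul_comm (g k : SU2) : halfTrace (g * k) = halfTrace (k * g) := by
  have h : (g * k).1.trace = (k * g).1.trace := Matrix.trace_mul_comm g.1 k.1
  rw [← two_mul_halfTrace, ← two_mul_halfTrace] at h
  have := Complex.ofReal_injective h
  linarith

lemma halfTrace_conj (g x : SU2) : halfTrace (g * x * g⁻¹) = halfTrace x := by
  rw [halfTrace_mul_comm]; simp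

lemma halfTrace_inv (x : SU2) : halfTrace x⁻¹ = halfTrace x := by
  simp [halfTrace, coe_inv, Matrix.star_apply]

lemma halfTrace_torus (θ : ℝ) : halfTrace (torus θ) = Real.cos θ := by
  simp [halfTrace, torus, Complex.exp_ofReal_mul_I_re]

lemma halfTrace_mem_Icc (g : SU2) : halfTrace g ∈ Set.Icc (-1 : ℝ) 1 := by
  have h := sum_sq g
  have : halfTrace g ^ 2 ≤ 1 := by
    simp only [halfTrace]
    nlinarith [sq_nonneg (g.1 0 0).im, sq_nonneg (g.1 1 0).re, sq_nonneg (g.1 1 0).im]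
  exact abs_le.mp (by rwa [← sq_le_one_iff_abs_le_one])

lemma continuous_torus : Continuous torus := by
  refine Continuous.subtype_mk ?_ _
  refine continuous_matrix fun i j => ?_
  fin_cases i <;> fin_cases j <;> simp <;> fun_prop

/-- Diagonalization in `SU(2)`. -/
lemma exists_conj_torus (x : SU2) (θ : ℝ) (hθ : Real.cos θ = halfTrace x) :
    ∃ g : SU2, x = g * torus θ * g⁻¹ := by
  set e : ℂ := Complex.exp (θ * Complex.I) with he
  have hee : e * conj e = 1 := by
    rw [he, ← Complex.exp_conj, ← Complex.exp_add]; simp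
  have hec : e + conj e = 2 * Real.cos θ := by
    rw [Complex.add_conj, he, Complex.exp_ofReal_mul_I_re]; push_cast; rfl
  have htr : x.1 0 0 + x.1 1 1 = e + conj e := by
    rw [hec, hθ, apply_one_one, Complex.add_conj, halfTrace]; push_cast; rfl
  -- With trace e + ē and determinant 1, the characteristic polynomial has root e. A normalized
  -- eigenvector is the first column of g; conjugating its equations shows that the second column of
  -- `ofColumn` is an eigenvector for ē.
  have hdet : (x.1 - Matrix.scalar (Fin 2) e).det = 0 := by
    rw [Matrix.det_fin_two]
    simp
    linear_combination det_eq_one x - e * htr - hee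
  obtain ⟨v, hv0, hv⟩ := Matrix.exists_mulVec_eq_zero_iff.mpr hdet
  have hv1 := congrFun hv 0
  have hv2 := congrFun hv 1
  simp [Matrix.mulVec, dotProduct, Fin.sum_univ_two] at hv1 hv2
  set N := Complex.normSq (v 0) + Complex.normSq (v 1) with hN
  have hNpos : 0 < N := by
    by_contra hcon
    have h0 := Complex.normSq_nonneg (v 0)
    have h1 := Complex.normSq_nonneg (v 1)
    have e0 : v 0 = 0 := Complex.normSq_eq_zero.mp (by linarith)
    have e1 : v 1 = 0 := Complex.normSq_eq_zero.mp (by linarith)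
    apply hv0
    ext i
    fin_cases i
    · exact e0
    · exact e1
  set c : ℂ := (((Real.sqrt N)⁻¹ : ℝ) : ℂ) with hc
  have hcc : Complex.normSq c * N = 1 := by
    rw [hc, Complex.normSq_ofReal, ← mul_inv, Real.mul_self_sqrt hNpos.le, inv_mul_cancel₀ hNpos.ne']
  refine ⟨ofColumn (c * v 0) (c * v 1) (by rw [map_mul, map_mul, ← mul_add, hcc]), ?_⟩
  rw [eq_mul_inv_iff_mul_eq]
  have h1 : (x.1 0 0) * v 0 + x.1 0 1 * v 1 = e * v 0 := by linear_combination hv1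
  have h2 : (x.1 1 0) * v 0 + x.1 1 1 * v 1 = e * v 1 := by linear_combination hv2
  rw [apply_zero_one] at h1
  rw [apply_one_one] at h2
  have h3 := congrArg conj h1
  have h4 := congrArg conj h2
  simp at h3 h4
  have hT : torus θ = ⟨!![e, 0; 0, conj e], by
      have := (torus θ).2; convert this using 1; simp [torus, he, ← Complex.exp_conj]⟩ := by
    apply Subtype.ext
    simp [torus, he, ← Complex.exp_conj]
  rw [hT]
  apply Subtype.ext
  ext i j
  rw [coe_mul_apply, coe_mul_apply]
  fin_cases i <;> fin_cases j <;> simp [ofColumn, apply_zero_one, apply_one_one]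
  · linear_combination c * h1
  · linear_combination (-conj c) * h4
  · linear_combination c * h2
  · linear_combination (conj c) * h3

lemma exists_conj_torus_arccos (x : SU2) :
    ∃ g : SU2, x = g * torus (Real.arccos (halfTrace x)) * g⁻¹ :=
  exists_conj_torus x _ (Real.cos_arccos (halfTrace_mem_Icc x).1 (halfTrace_mem_Icc x).2)

/-- A class function depends on the trace only. -/
lemma classFunction_eq {X : Type*} (φ : SU2 → X) (hφ : ∀ g x, φ (g * x * g⁻¹) = φ x)
    {x y : SU2} (h : halfTrace x = halfTrace y) : φ x = φ y := by
  obtain ⟨g, hg⟩ := exists_conj_torus_arccos x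
  obtain ⟨k, hk⟩ := exists_conj_torus_arccos y
  rw [hg, hk, hφ, hφ, h]

end

/-! ### Moments of the Haar measure. -/

section

open Matrix ComplexConjugate

lemma continuous_re_entry (i j : Fin 2) : Continuous fun g : SU2 => (g.1 i j).re :=
  Complex.continuous_re.comp (continuous_entry i j)

lemma continuous_im_entry (i j : Fin 2) : Continuous fun g : SU2 => (g.1 i j).im :=
  Complex.continuous_im.comp (continuous_entry i j)

lemma integrable_haar_of_continuous {f : SU2 → ℝ} (hf : Continuous f) : Integrable f haar :=
  hf.integrable_of_hasCompactSupport (HasCompactSupport.of_compactSpace f)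

lemma integral_haar_eq_add {f f₁ f₂ : SU2 → ℝ} (h₁ : Continuous f₁) (h₂ : Continuous f₂)
    (h : ∀ g, f g = f₁ g + f₂ g) :
    ∫ g, f g ∂haar = ∫ g, f₁ g ∂haar + ∫ g, f₂ g ∂haar := by
  rw [← integral_add (integrable_haar_of_continuous h₁) (integrable_haar_of_continuous h₂)]
  exact integral_congr_ae (Filter.Eventually.of_forall h)

/-- Integration by parts along a one-parameter family of left translations that rotates the
functions `X` and `Y` into one another and fixes `w`. -/
lemma integral_pow_mul_of_rotation {X Y w : SU2 → ℝ} (hX : Continuous X) (hY : Continuous Y)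
    (hw : Continuous w) (r : ℝ → SU2)
    (hrX : ∀ s g, X (r s * g) = X g * Real.cos s - Y g * Real.sin s)
    (hrY : ∀ s g, Y (r s * g) = X g * Real.sin s + Y g * Real.cos s)
    (hrw : ∀ s g, w (r s * g) = w g) (p : ℕ) :
    ∫ g, X g ^ (p + 2) * w g ∂haar = (p + 1) * ∫ g, X g ^ p * Y g ^ 2 * w g ∂haar := by
  let U : ℝ → SU2 → ℝ := fun s g => X g * Real.cos s - Y g * Real.sin s
  let V : ℝ → SU2 → ℝ := fun s g => X g * Real.sin s + Y g * Real.cos s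
  let F : ℝ → SU2 → ℝ := fun s g => U s g ^ (p + 1) * V s g * w g
  let F' : ℝ → SU2 → ℝ := fun s g =>
    ((((p + 1 : ℕ) : ℝ) * U s g ^ p * (-V s g)) * V s g + U s g ^ (p + 1) * U s g) * w g
  -- `F s` is the left translate of X^(p+1) Y w by `r s`, so its integral does not depend on s; the
  -- identity is the vanishing of the derivative at s = 0.
  have hconst : ∀ s, ∫ g, F s g ∂haar = ∫ g, X g ^ (p + 1) * Y g * w g ∂haar := by
    intro s
    rw [← integral_mul_left_eq_self (μ := haar) (fun g => X g ^ (p + 1) * Y g * w g) (r s)]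
    simp only [hrX, hrY, hrw, F, U, V]
  have hF'c : Continuous (fun q : ℝ × SU2 => F' q.1 q.2) := by
    simp only [F', U, V]; fun_prop
  obtain ⟨C, hC⟩ := ((isCompact_Icc (a := (-1 : ℝ)) (b := 1)).prod
    (isCompact_univ (X := SU2))).exists_bound_of_continuousOn hF'c.continuousOn
  have hFc : ∀ s, Continuous (F s) := by
    intro s; simp only [F, U, V]; fun_prop
  have hd := hasDerivAt_integral_of_dominated_loc_of_deriv_le (μ := haar) (F := F) (F' := F')
    (x₀ := 0) (s := Set.Icc (-1) 1) (bound := fun _ => C)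
    (Icc_mem_nhds (by norm_num) (by norm_num))
    (Filter.Eventually.of_forall fun s => (hFc s).aestronglyMeasurable)
    (integrable_haar_of_continuous (hFc 0))
    (hF'c.comp (Continuous.prodMk_right (0 : ℝ))).aestronglyMeasurable
    (Filter.Eventually.of_forall fun g s hs => hC (s, g) ⟨hs, Set.mem_univ _⟩)
    (integrable_const _)
    (Filter.Eventually.of_forall fun g s _ => by
      have hU : HasDerivAt (fun s => U s g) (-V s g) s := by
        convert! ((Real.hasDerivAt_cos s).const_mul (X g)).sub
          ((Real.hasDerivAt_sin s).const_mul (Y g)) using 1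
        simp only [V]; ring
      have hV : HasDerivAt (fun s => V s g) (U s g) s := by
        convert! ((Real.hasDerivAt_sin s).const_mul (X g)).add
          ((Real.hasDerivAt_cos s).const_mul (Y g)) using 1
        simp only [U]; ring
      simpa [F, F'] using ((hU.pow (p + 1)).mul hV).mul_const (w g))
  have h0 : ∫ g, F' 0 g ∂haar = 0 := by
    refine hd.2.unique ?_
    simp only [hconst]
    exact hasDerivAt_const _ _
  have hF0 : ∀ g, F' 0 g = X g ^ (p + 2) * w g - (p + 1) * (X g ^ p * Y g ^ 2 * w g) := by
    intro g; simp [F', U, V]; ring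
  simp only [hF0] at h0
  rw [integral_sub (integrable_haar_of_continuous (by fun_prop))
    (integrable_haar_of_continuous (by fun_prop)), integral_const_mul] at h0
  linarith

/-- The squared modulus of the upper left entry. -/
def diagSq (g : SU2) : ℝ := Complex.normSq (g.1 0 0)

lemma continuous_diagSq : Continuous diagSq :=
  Complex.continuous_normSq.comp (continuous_entry 0 0)

lemma diagSq_mem_Icc (g : SU2) : diagSq g ∈ Set.Icc (0 : ℝ) 1 := by
  have h := sum_sq g
  simp only [diagSq, Complex.normSq_apply]
  constructor <;>
  nlinarith [sq_nonneg (g.1 0 0).im, sq_nonneg (g.1 0 0).re, sq_nonneg (g.1 1 0).re,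
    sq_nonneg (g.1 1 0).im]

lemma integral_halfTrace_pow_mul_im_sq (p q : ℕ) :
    ∫ g, halfTrace g ^ (p + 2) * diagSq g ^ q ∂haar =
      (p + 1) * ∫ g, halfTrace g ^ p * (g.1 0 0).im ^ 2 * diagSq g ^ q ∂haar := by
  have key : ∀ s : ℝ, ∀ g : SU2, (torus s * g).1 0 0 = Complex.exp (s * Complex.I) * g.1 0 0 := by
    intro s g; rw [coe_mul_apply]; simp [torus]
  refine integral_pow_mul_of_rotation continuous_halfTrace (continuous_im_entry 0 0)
    (continuous_diagSq.pow q) torus ?_ ?_ ?_ p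
  · intro s g
    simp only [halfTrace, key, Complex.mul_re, Complex.exp_ofReal_mul_I_re,
      Complex.exp_ofReal_mul_I_im]; ring
  · intro s g
    simp only [halfTrace, key, Complex.mul_im, Complex.exp_ofReal_mul_I_re,
      Complex.exp_ofReal_mul_I_im]; ring
  · intro s g
    change diagSq _ ^ q = diagSq _ ^ q
    simp only [diagSq, key, map_mul]
    simp [Complex.normSq_eq_norm_sq, Complex.norm_exp_ofReal_mul_I]

lemma integral_halfTrace_pow_re_sq (p : ℕ) :
    ∫ g, halfTrace g ^ (p + 2) ∂haar =
      (p + 1) * ∫ g, halfTrace g ^ p * (g.1 1 0).re ^ 2 ∂haar := by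
  have := integral_pow_mul_of_rotation continuous_halfTrace (continuous_re_entry 1 0)
    (continuous_const (y := (1 : ℝ)))
    (fun s => ofColumn (Real.cos s) (Real.sin s) (by
      rw [Complex.normSq_ofReal, Complex.normSq_ofReal, ← sq, ← sq, Real.cos_sq_add_sin_sq]))
    ?_ ?_ (fun _ _ => rfl) p
  · simpa using this
  · intro s g
    simp only [halfTrace, coe_mul_apply]
    simp [ofColumn, -Complex.ofReal_cos, -Complex.ofReal_sin]; ring
  · intro s g
    simp only [halfTrace, coe_mul_apply]
    simp [ofColumn, -Complex.ofReal_cos, -Complex.ofReal_sin]; ring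

lemma integral_halfTrace_pow_im_sq (p : ℕ) :
    ∫ g, halfTrace g ^ (p + 2) ∂haar =
      (p + 1) * ∫ g, halfTrace g ^ p * (g.1 1 0).im ^ 2 ∂haar := by
  have := integral_pow_mul_of_rotation continuous_halfTrace (continuous_im_entry 1 0)
    (continuous_const (y := (1 : ℝ)))
    (fun s => ofColumn (Real.cos s) (Real.sin s * Complex.I) (by
      rw [map_mul, Complex.normSq_ofReal, Complex.normSq_ofReal, Complex.normSq_I, mul_one,
        ← sq, ← sq, Real.cos_sq_add_sin_sq]))
    ?_ ?_ (fun _ _ => rfl) p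
  · simpa using this
  · intro s g
    simp only [halfTrace, coe_mul_apply]
    simp [ofColumn, -Complex.ofReal_cos, -Complex.ofReal_sin]; ring
  · intro s g
    simp only [halfTrace, coe_mul_apply]
    simp [ofColumn, -Complex.ofReal_cos, -Complex.ofReal_sin]; ring

/-- Multiply X^n by the equation of the unit 3-sphere: each of the three coordinates other than X
contributes the same multiple of the moment of order n + 2. -/
lemma integral_halfTrace_pow_add_two (n : ℕ) :
    (n + 4) * ∫ g, halfTrace g ^ (n + 2) ∂haar = (n + 1) * ∫ g, halfTrace g ^ n ∂haar := by
  have h1 := integral_halfTrace_pow_mul_im_sq n 0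
  have h2 := integral_halfTrace_pow_re_sq n
  have h3 := integral_halfTrace_pow_im_sq n
  simp only [pow_zero, mul_one] at h1
  have c0 := continuous_halfTrace
  have c1 := continuous_im_entry 0 0
  have c2 := continuous_re_entry 1 0
  have c3 := continuous_im_entry 1 0
  have hsum : ∫ g, halfTrace g ^ n ∂haar = ∫ g, halfTrace g ^ (n + 2) ∂haar +
      (∫ g, halfTrace g ^ n * (g.1 0 0).im ^ 2 ∂haar +
      (∫ g, halfTrace g ^ n * (g.1 1 0).re ^ 2 ∂haar +
      ∫ g, halfTrace g ^ n * (g.1 1 0).im ^ 2 ∂haar)) := by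
    have i1 : Continuous (fun g : SU2 => halfTrace g ^ n * (g.1 0 0).im ^ 2) :=
      (c0.pow _).mul (c1.pow 2)
    have i2 : Continuous (fun g : SU2 => halfTrace g ^ n * (g.1 1 0).re ^ 2) :=
      (c0.pow _).mul (c2.pow 2)
    have i3 : Continuous (fun g : SU2 => halfTrace g ^ n * (g.1 1 0).im ^ 2) :=
      (c0.pow _).mul (c3.pow 2)
    have i23 : Continuous (fun g : SU2 => halfTrace g ^ n * (g.1 1 0).re ^ 2 +
        halfTrace g ^ n * (g.1 1 0).im ^ 2) := i2.add i3
    rw [← integral_haar_eq_add i2 i3 fun _ => rfl,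
      ← integral_haar_eq_add i1 i23 fun _ => rfl]
    refine integral_haar_eq_add (c0.pow _) (i1.add i23) fun g => ?_
    have := sum_sq g
    simp only [halfTrace]
    linear_combination (-(g.1 0 0).re ^ n) * this
  rw [hsum]
  linear_combination h1 + h2 + h3

lemma integral_halfTrace_pow_one : ∫ g, halfTrace g ^ 1 ∂haar = 0 := by
  have h : ∫ g, halfTrace g ^ 1 ∂haar = ∫ g, -(halfTrace g ^ 1) ∂haar := by
    -- `torus π` is -1, which reverses the sign of the trace.
    rw [← integral_mul_left_eq_self (μ := haar) (fun g => halfTrace g ^ 1) (torus Real.pi)]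
    refine integral_congr_ae (Filter.Eventually.of_forall fun g => ?_)
    simp only [halfTrace, coe_mul_apply]
    simp [torus]
  rw [integral_neg] at h
  linarith

/-- The torus rotates the plane of the upper left entry and fixes `diagSq`, which is the sum of the
squares of the two coordinates of that plane. -/
lemma integral_halfTrace_pow_mul_diagSq_pow (p q : ℕ) :
    (p + 2) * ∫ g, halfTrace g ^ (p + 2) * diagSq g ^ q ∂haar =
      (p + 1) * ∫ g, halfTrace g ^ p * diagSq g ^ (q + 1) ∂haar := by
  have h1 := integral_halfTrace_pow_mul_im_sq p q
  have c0 := continuous_halfTrace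
  have c1 := continuous_im_entry 0 0
  have c2 := continuous_diagSq
  have hsum : ∫ g, halfTrace g ^ p * diagSq g ^ (q + 1) ∂haar =
      ∫ g, halfTrace g ^ (p + 2) * diagSq g ^ q ∂haar +
      ∫ g, halfTrace g ^ p * (g.1 0 0).im ^ 2 * diagSq g ^ q ∂haar := by
    refine integral_haar_eq_add ((c0.pow _).mul (c2.pow _))
      (((c0.pow _).mul (c1.pow 2)).mul (c2.pow _)) fun g => ?_
    simp only [diagSq, halfTrace, Complex.normSq_apply]
    ring
  rw [hsum]
  linear_combination h1

lemma integral_halfTrace_even_pow_mul_diagSq_pow (n : ℕ) : ∀ q : ℕ,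
    ∫ g, halfTrace g ^ (2 * n) * diagSq g ^ q ∂haar =
      (∏ j ∈ Finset.range n, ((2 * j + 1 : ℝ) / (2 * j + 2))) *
        ∫ g, diagSq g ^ (n + q) ∂haar := by
  induction n with
  | zero => intro q; simp
  | succ n ih =>
    intro q
    have h := integral_halfTrace_pow_mul_diagSq_pow (2 * n) q
    rw [ih (q + 1)] at h
    rw [Finset.prod_range_succ, show n + 1 + q = n + (q + 1) by ring,
      show 2 * (n + 1) = 2 * n + 2 by ring]
    push_cast at h
    apply mul_left_cancel₀ (show (2 * (n : ℝ) + 2) ≠ 0 by positivity)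
    rw [h]
    field_simp

lemma integral_halfTrace_even_pow (n : ℕ) :
    ∫ g, halfTrace g ^ (2 * n) ∂haar =
      (∏ j ∈ Finset.range n, ((2 * j + 1 : ℝ) / (2 * j + 2))) * (1 / (n + 1)) := by
  induction n with
  | zero => simp
  | succ n ih =>
    have h := integral_halfTrace_pow_add_two (2 * n)
    rw [ih] at h
    rw [Finset.prod_range_succ, show 2 * (n + 1) = 2 * n + 2 by ring]
    push_cast at h ⊢
    have h4 : (2 * (n : ℝ) + 4) ≠ 0 := by positivity
    apply mul_left_cancel₀ h4
    rw [h]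
    field_simp
    ring

/-- The even moments of `halfTrace` are known in two ways, from rotations of the whole 3-sphere and
from rotations of one plane; the common product cancels. -/
lemma integral_diagSq_pow (n : ℕ) : ∫ g, diagSq g ^ n ∂haar = 1 / (n + 1) := by
  have h := integral_halfTrace_even_pow_mul_diagSq_pow n 0
  simp only [pow_zero, mul_one, add_zero, integral_halfTrace_even_pow] at h
  refine (mul_left_cancel₀ ?_ h).symm
  exact Finset.prod_ne_zero_iff.mpr fun j _ => by positivity

end

/-! ### The laws of `diagSq` and `halfTrace`; Weyl integration. -/

section

open Set

/-- Two finite measures on the line carried by a bounded interval are equal if they have the same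
moments. -/
lemma measure_eq_of_moments {μ ν : Measure ℝ} [IsFiniteMeasure μ] [IsFiniteMeasure ν] {a b : ℝ}
    (hμ : ∀ᵐ x ∂μ, x ∈ Icc a b) (hν : ∀ᵐ x ∂ν, x ∈ Icc a b)
    (h : ∀ n : ℕ, ∫ x, x ^ n ∂μ = ∫ x, x ^ n ∂ν) : μ = ν := by
  have hint : ∀ (κ : Measure ℝ) [IsFiniteMeasure κ], (∀ᵐ x ∂κ, x ∈ Icc a b) →
      ∀ f : ℝ → ℝ, Continuous f → Integrable f κ := by
    intro κ _ hκ f hf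
    obtain ⟨C, hC⟩ := (isCompact_Icc (a := a) (b := b)).exists_bound_of_continuousOn
      hf.continuousOn
    exact Integrable.of_bound hf.aestronglyMeasurable C (hκ.mono hC)
  have hpoly : ∀ p : Polynomial ℝ, ∫ x, p.eval x ∂μ = ∫ x, p.eval x ∂ν := by
    intro p
    simp only [Polynomial.eval_eq_sum_range]
    rw [integral_finsetSum _ fun i _ => hint μ hμ _ (by fun_prop),
      integral_finsetSum _ fun i _ => hint ν hν _ (by fun_prop)]
    simp only [integral_const_mul, h]
  refine ext_of_forall_integral_eq_of_IsFiniteMeasure fun f => ?_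
  have hclose : ∀ (κ : Measure ℝ) [IsFiniteMeasure κ], (∀ᵐ x ∂κ, x ∈ Icc a b) →
      ∀ (p : Polynomial ℝ) (ε : ℝ), (∀ x ∈ Icc a b, |p.eval x - f x| < ε) →
      |∫ x, p.eval x ∂κ - ∫ x, f x ∂κ| ≤ ε * κ.real univ := by
    intro κ _ hκ p ε hp
    rw [← integral_sub (hint κ hκ _ p.continuous) (hint κ hκ _ f.continuous), ← Real.norm_eq_abs]
    exact norm_integral_le_of_norm_le_const (hκ.mono fun x hx => (hp x hx).le)
  refine eq_of_forall_dist_le fun ε hε => ?_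
  -- The added 1 keeps M positive when both measures vanish.
  set M := μ.real univ + ν.real univ + 1 with hM
  have hMpos : 0 < M := by positivity
  obtain ⟨p, hp⟩ := exists_polynomial_near_of_continuousOn a b f f.continuous.continuousOn (ε / M)
    (by positivity)
  have h1 := hclose μ hμ p _ hp
  have h2 := hclose ν hν p _ hp
  rw [hpoly p] at h1
  rw [Real.dist_eq]
  have h3 : ε / M * μ.real univ + ε / M * ν.real univ ≤ ε := by
    calc _ ≤ ε / M * M := by rw [hM]; have : 0 ≤ ε / M := by positivity
                             nlinarith
      _ = ε := by field_simp
  rw [abs_le] at *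
  constructor <;> linarith [h1.1, h1.2, h2.1, h2.2]

/-- The squared modulus of the diagonal entry is uniformly distributed on `[0, 1]`. -/
lemma map_diagSq_haar : Measure.map diagSq haar = volume.restrict (Icc 0 1) := by
  have hm := continuous_diagSq.measurable
  have : IsProbabilityMeasure (Measure.map diagSq haar) :=
    Measure.isProbabilityMeasure_map hm.aemeasurable
  refine measure_eq_of_moments (a := 0) (b := 1) ?_ (ae_restrict_mem measurableSet_Icc) fun n => ?_
  · exact (ae_map_iff (p := (· ∈ Icc (0 : ℝ) 1)) hm.aemeasurable measurableSet_Icc).mpr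
      (Filter.Eventually.of_forall diagSq_mem_Icc)
  · rw [integral_map hm.aemeasurable (by fun_prop), integral_diagSq_pow,
      integral_Icc_eq_integral_Ioc, ← intervalIntegral.integral_of_le zero_le_one, integral_pow]
    simp

/-- The distribution of the angle `arccos (tr / 2)` under the Haar probability measure. -/
noncomputable def angleMeasure : Measure ℝ :=
  (volume.restrict (Icc 0 Real.pi)).withDensity
    fun θ => ENNReal.ofReal (2 / Real.pi * Real.sin θ ^ 2)

lemma integral_angleMeasure (f : ℝ → ℝ) :
    ∫ θ, f θ ∂angleMeasure = ∫ θ in Icc 0 Real.pi, 2 / Real.pi * Real.sin θ ^ 2 * f θ := by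
  rw [angleMeasure, integral_withDensity_eq_integral_toReal_smul (by fun_prop) (by simp)]
  refine integral_congr_ae (Filter.Eventually.of_forall fun θ => ?_)
  simp only [smul_eq_mul]
  rw [ENNReal.toReal_ofReal (by positivity)]

instance instIsFiniteMeasureAngleMeasure : IsFiniteMeasure angleMeasure := by
  refine isFiniteMeasure_withDensity_ofReal ?_
  refine Integrable.hasFiniteIntegral ?_
  exact (Continuous.integrableOn_Icc (by fun_prop))

lemma integral_cos_pow_angleMeasure (n : ℕ) :
    ∫ θ, Real.cos θ ^ n ∂angleMeasure =
      2 / Real.pi * ((∫ θ in (0 : ℝ)..Real.pi, Real.cos θ ^ n) / (n + 2)) := by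
  rw [integral_angleMeasure, integral_Icc_eq_integral_Ioc,
    ← intervalIntegral.integral_of_le Real.pi_pos.le]
  have h : ∀ θ : ℝ, 2 / Real.pi * Real.sin θ ^ 2 * Real.cos θ ^ n =
      2 / Real.pi * (Real.cos θ ^ n - Real.cos θ ^ (n + 2)) := by
    intro θ; rw [Real.sin_sq]; ring
  simp only [h]
  rw [intervalIntegral.integral_const_mul, intervalIntegral.integral_sub
    (Continuous.intervalIntegrable (by fun_prop) _ _)
    (Continuous.intervalIntegrable (by fun_prop) _ _), integral_cos_pow]
  simp
  field_simp
  ring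

/-- Both sides satisfy the same two-step recurrence, on the right by the reduction formula for
powers of the cosine, and agree for n = 0, 1. -/
lemma integral_halfTrace_pow (n : ℕ) :
    ∫ g, halfTrace g ^ n ∂haar = ∫ θ, Real.cos θ ^ n ∂angleMeasure := by
  induction n using Nat.twoStepInduction with
  | zero => rw [integral_cos_pow_angleMeasure]; simp
  | one => rw [integral_cos_pow_angleMeasure, integral_halfTrace_pow_one]; simp
  | more n ih _ =>
    have h := integral_halfTrace_pow_add_two n
    rw [ih, integral_cos_pow_angleMeasure] at h
    rw [integral_cos_pow_angleMeasure, integral_cos_pow]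
    apply mul_left_cancel₀ (show ((n : ℝ) + 4) ≠ 0 by positivity)
    rw [h]
    simp
    field_simp
    ring

/-- The Weyl integration formula for `SU(2)`. -/
lemma map_halfTrace_haar : Measure.map halfTrace haar = Measure.map Real.cos angleMeasure := by
  have hm := measurable_halfTrace
  have hc := Real.continuous_cos.measurable
  refine measure_eq_of_moments (a := -1) (b := 1) ?_ ?_ fun n => ?_
  · exact (ae_map_iff (p := (· ∈ Icc (-1 : ℝ) 1)) hm.aemeasurable measurableSet_Icc).mpr
      (Filter.Eventually.of_forall halfTrace_mem_Icc)
  · exact (ae_map_iff (p := (· ∈ Icc (-1 : ℝ) 1)) hc.aemeasurable measurableSet_Icc).mpr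
      (Filter.Eventually.of_forall Real.cos_mem_Icc)
  · rw [integral_map hm.aemeasurable (by fun_prop), integral_map hc.aemeasurable (by fun_prop),
      integral_halfTrace_pow]

lemma integral_comp_halfTrace_haar {f : ℝ → ℝ} (hf : Measurable f) :
    ∫ g, f (halfTrace g) ∂haar =
      ∫ θ in Icc 0 Real.pi, 2 / Real.pi * Real.sin θ ^ 2 * f (Real.cos θ) := by
  rw [← integral_map measurable_halfTrace.aemeasurable hf.aestronglyMeasurable, map_halfTrace_haar,
    integral_map Real.continuous_cos.measurable.aemeasurable hf.aestronglyMeasurable,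
    integral_angleMeasure]

end

/-! ### Conjugation invariant measures and the trace law of the convolution. -/

section

open Set

lemma continuous_conj_apply (g : SU2) : Continuous fun x : SU2 => g * x * g⁻¹ := by fun_prop

lemma measurable_conj_apply (g : SU2) : Measurable fun x : SU2 => g * x * g⁻¹ :=
  (continuous_conj_apply g).measurable

lemma measurable_conj_prod : Measurable fun q : SU2 × SU2 => q.1 * q.2 * q.1⁻¹ :=
  (by fun_prop : Continuous fun q : SU2 × SU2 => q.1 * q.2 * q.1⁻¹).measurable

/-- A conjugation invariant measure is determined by the distribution of the trace. -/
lemma apply_eq_lintegral_map_halfTrace {ρ : Measure SU2} [SFinite ρ]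
    (hρ : ∀ g : SU2, Measure.map (fun x => g * x * g⁻¹) ρ = ρ) {A : Set SU2}
    (hA : MeasurableSet A) :
    ρ A = ∫⁻ c, haar {g | g * torus (Real.arccos c) * g⁻¹ ∈ A} ∂(Measure.map halfTrace ρ) := by
  have hmeas : Measurable fun c => haar {g | g * torus (Real.arccos c) * g⁻¹ ∈ A} := by
    have hT : Measurable fun c : ℝ => torus (Real.arccos c) :=
      (continuous_torus.comp Real.continuous_arccos).measurable
    have : MeasurableSet {q : ℝ × SU2 | q.2 * torus (Real.arccos q.1) * q.2⁻¹ ∈ A} :=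
      (measurable_conj_prod.comp (measurable_snd.prodMk (hT.comp measurable_fst))) hA
    exact measurable_measure_prodMk_left this
  rw [lintegral_map hmeas measurable_halfTrace]
  have hS : MeasurableSet {q : SU2 × SU2 | q.1 * q.2 * q.1⁻¹ ∈ A} := measurable_conj_prod hA
  -- Average the invariance of ρ over all conjugations and exchange the integrals. Right invariance
  -- of Haar measure then absorbs the element k that diagonalizes x.
  calc ρ A = ∫⁻ _ : SU2, ρ A ∂haar := by simp
    _ = ∫⁻ g, ρ {x | g * x * g⁻¹ ∈ A} ∂haar := by
        refine lintegral_congr fun g => ?_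
        conv_lhs => rw [← hρ g]
        rw [Measure.map_apply (measurable_conj_apply g) hA]
        rfl
    _ = (haar.prod ρ) {q : SU2 × SU2 | q.1 * q.2 * q.1⁻¹ ∈ A} := (Measure.prod_apply hS).symm
    _ = ∫⁻ x, haar {g | g * x * g⁻¹ ∈ A} ∂ρ := Measure.prod_apply_symm hS
    _ = _ := by
        refine lintegral_congr fun x => ?_
        obtain ⟨k, hk⟩ := exists_conj_torus_arccos x
        set t := torus (Real.arccos (halfTrace x))
        have : {g | g * x * g⁻¹ ∈ A} = (fun g => g * k) ⁻¹' {g | g * t * g⁻¹ ∈ A} := by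
          ext g
          rw [hk]
          simp [mul_assoc]
        rw [this, measure_preimage_mul_right]

lemma eq_of_map_halfTrace_eq {ρ ρ' : Measure SU2} [SFinite ρ] [SFinite ρ']
    (hρ : ∀ g : SU2, Measure.map (fun x => g * x * g⁻¹) ρ = ρ)
    (hρ' : ∀ g : SU2, Measure.map (fun x => g * x * g⁻¹) ρ' = ρ')
    (h : Measure.map halfTrace ρ = Measure.map halfTrace ρ') : ρ = ρ' := by
  ext A hA
  rw [apply_eq_lintegral_map_halfTrace hρ hA, apply_eq_lintegral_map_halfTrace hρ' hA, h]

lemma map_conj_haar (k : SU2) : Measure.map (fun x => k * x * k⁻¹) haar = haar := by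
  have h := Measure.map_map (μ := haar) (g := fun x => x * k⁻¹) (f := fun x => k * x)
    (measurable_mul_const _) (measurable_const_mul _)
  rw [map_mul_left_eq_self, map_mul_right_eq_self] at h
  exact h.symm

lemma classMeasure_eq (θ : ℝ) : classMeasure θ = ENNReal.ofReal (4 * Real.pi * Real.sin θ ^ 2) •
    Measure.map (fun g : SU2 => g * torus θ * g⁻¹) haar := rfl

lemma vol_eq : vol = ENNReal.ofReal (4 * Real.pi ^ 2) • haar := rfl

lemma map_conj_classMeasure (θ : ℝ) (k : SU2) :
    Measure.map (fun x => k * x * k⁻¹) (classMeasure θ) = classMeasure θ := by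
  have ho : Measurable fun g : SU2 => g * torus θ * g⁻¹ :=
    (by fun_prop : Continuous fun g : SU2 => g * torus θ * g⁻¹).measurable
  rw [classMeasure_eq, Measure.map_smul, Measure.map_map (measurable_conj_apply k) ho]
  congr 1
  conv_rhs => rw [← map_mul_left_eq_self haar k]
  rw [Measure.map_map ho (measurable_const_mul k)]
  congr 1
  ext1 g
  simp [mul_assoc]

instance instIsFiniteMeasureClassMeasure (θ : ℝ) : IsFiniteMeasure (classMeasure θ) := by
  rw [classMeasure_eq]
  exact Measure.smul_finite _ ENNReal.ofReal_ne_top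

instance instIsFiniteMeasureVol : IsFiniteMeasure vol := by
  rw [vol_eq]
  exact Measure.smul_finite _ ENNReal.ofReal_ne_top

lemma map_conj_mconv (α β : ℝ) (k : SU2) :
    Measure.map (fun x => k * x * k⁻¹) (Measure.mconv (classMeasure α) (classMeasure β)) =
      Measure.mconv (classMeasure α) (classMeasure β) := by
  have hc := measurable_conj_apply k
  have hm : Measurable fun q : SU2 × SU2 => q.1 * q.2 := measurable_mul
  conv_rhs => rw [← map_conj_classMeasure α k, ← map_conj_classMeasure β k]
  rw [Measure.mconv, Measure.mconv, Measure.map_prod_map _ _ hc hc, Measure.map_map hc hm,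
    Measure.map_map hm (hc.prodMap hc)]
  congr 1
  ext1 q
  simp [mul_assoc]

lemma integral_classMeasure (θ : ℝ) {f : SU2 → ℝ} (hf : Measurable f) :
    ∫ x, f x ∂(classMeasure θ) =
      4 * Real.pi * Real.sin θ ^ 2 * ∫ g, f (g * torus θ * g⁻¹) ∂haar := by
  have ho : Measurable fun g : SU2 => g * torus θ * g⁻¹ :=
    (by fun_prop : Continuous fun g : SU2 => g * torus θ * g⁻¹).measurable
  rw [classMeasure_eq, integral_smul_measure, integral_map ho.aemeasurable hf.aestronglyMeasurable,
    ENNReal.toReal_ofReal (by have := Real.pi_pos; positivity), smul_eq_mul]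

lemma torusDensity_of_classFunction {h : SU2 → ℝ} (hm : Measurable h)
    (hc : ∀ g x, h (g * x * g⁻¹) = h x) (θ : ℝ) :
    torusDensity h θ = 4 * Real.pi * Real.sin θ ^ 2 * h (torus θ) := by
  rw [torusDensity, integral_classMeasure θ (f := fun x => h x⁻¹) (hm.comp measurable_inv)]
  congr 1
  have : ∀ g : SU2, h (g * torus θ * g⁻¹)⁻¹ = h (torus θ) := fun g =>
    classFunction_eq h hc (by rw [halfTrace_inv, halfTrace_conj])
  simp only [this, integral_const, probReal_univ, one_smul]

/-- With u = |k₀₀|², the upper left entry of k t_β k⁻¹ is u e^{iβ} + (1-u) e^{-iβ}, so the half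
trace interpolates linearly between cos(α-β) and cos(α+β). -/
lemma halfTrace_torus_mul_conj_torus (α β : ℝ) (k : SU2) :
    halfTrace (torus α * (k * torus β * k⁻¹)) =
      Real.cos (α - β) - 2 * Real.sin α * Real.sin β * diagSq k := by
  have h := sum_sq k
  simp only [halfTrace, diagSq, coe_mul_apply, coe_inv, Matrix.star_apply, apply_zero_one]
  simp [torus, Complex.exp_re,
    Complex.exp_im, Complex.normSq_apply, Real.cos_sub]
  linear_combination (Real.cos α * Real.cos β + Real.sin α * Real.sin β) * h

lemma integral_comp_halfTrace_mconv {α β : ℝ} (hα : 0 < Real.sin α) (hβ : 0 < Real.sin β)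
    {F : ℝ → ℝ} (hF : Continuous F) :
    ∫ x, F (halfTrace x) ∂(Measure.mconv (classMeasure α) (classMeasure β)) =
      8 * Real.pi ^ 2 * Real.sin α * Real.sin β *
        ∫ t in Real.cos (α + β)..Real.cos (α - β), F t := by
  have hc : Continuous fun x => F (halfTrace x) := hF.comp continuous_halfTrace
  have hmul : Continuous fun q : SU2 × SU2 => F (halfTrace (q.1 * q.2)) :=
    hc.comp continuous_mul
  have hin : Continuous fun q : SU2 × SU2 =>
      F (halfTrace (q.1 * (q.2 * torus β * q.2⁻¹))) :=
    hc.comp (by fun_prop : Continuous fun q : SU2 × SU2 => q.1 * (q.2 * torus β * q.2⁻¹))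
  have hint : Integrable (fun q : SU2 × SU2 => F (halfTrace (q.1 * q.2)))
      ((classMeasure α).prod (classMeasure β)) :=
    hmul.integrable_of_hasCompactSupport (HasCompactSupport.of_compactSpace _)
  -- Replacing k by gk conjugates the whole product by g, so the inner integral does not depend on
  -- g.
  have hconst : ∀ g : SU2, ∫ k, F (halfTrace (g * torus α * g⁻¹ * (k * torus β * k⁻¹))) ∂haar =
      ∫ u in (0 : ℝ)..1, F (Real.cos (α - β) - 2 * Real.sin α * Real.sin β * u) := by
    intro g
    rw [← integral_mul_left_eq_self (μ := haar) _ g]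
    have : ∀ k : SU2, halfTrace (g * torus α * g⁻¹ * (g * k * torus β * (g * k)⁻¹)) =
        Real.cos (α - β) - 2 * Real.sin α * Real.sin β * diagSq k := by
      intro k
      rw [← halfTrace_torus_mul_conj_torus, ← halfTrace_conj g (torus α * _)]
      simp [mul_assoc]
    simp only [this]
    rw [← integral_map (f := fun u => F (Real.cos (α - β) - 2 * Real.sin α * Real.sin β * u))
      continuous_diagSq.measurable.aemeasurable (by fun_prop), map_diagSq_haar,
      integral_Icc_eq_integral_Ioc, ← intervalIntegral.integral_of_le zero_le_one]
  rw [Measure.mconv, integral_map measurable_mul.aemeasurable hc.aestronglyMeasurable,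
    integral_prod _ hint]
  have hinner : ∀ x : SU2, ∫ y, F (halfTrace (x * y)) ∂(classMeasure β) =
      4 * Real.pi * Real.sin β ^ 2 * ∫ k, F (halfTrace (x * (k * torus β * k⁻¹))) ∂haar :=
    fun x => integral_classMeasure β (hc.comp (continuous_const_mul x)).measurable
  simp only [hinner]
  rw [integral_const_mul, integral_classMeasure α
    (f := fun x => ∫ k, F (halfTrace (x * (k * torus β * k⁻¹))) ∂haar)
    (hin.stronglyMeasurable.integral_prod_right).measurable]
  simp only [hconst, integral_const, probReal_univ, one_smul]
  -- The slope 2 sin α sin β divides the total mass 16π² sin²α sin²β, leaving 8π² sin α sin β.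
  rw [intervalIntegral.integral_comp_sub_mul F (by positivity)]
  have e1 : Real.cos (α - β) - 2 * Real.sin α * Real.sin β * 1 = Real.cos (α + β) := by
    rw [Real.cos_sub, Real.cos_add]; ring
  rw [e1, mul_zero, sub_zero, smul_eq_mul]
  field_simp
  ring

/-- For continuous F the substitution needs no injectivity of the cosine, so [a, b] may extend
beyond π. -/
lemma integral_cos_substitution {F : ℝ → ℝ} (hF : Continuous F) (a b : ℝ) :
    ∫ t in Real.cos b..Real.cos a, F t = ∫ θ in a..b, F (Real.cos θ) * Real.sin θ := by
  have h := intervalIntegral.integral_comp_mul_deriv (a := b) (b := a) (f := Real.cos)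
    (f' := fun θ => -Real.sin θ) (g := F) (fun x _ => Real.hasDerivAt_cos x)
    (Continuous.continuousOn (by fun_prop)) hF
  rw [← h, intervalIntegral.integral_symm]
  simp

end

/-! ### The density on the group and its unfolding on the circle. -/

section

open Set

/-- The density of `μ_α ⋆ μ_β` as a function of the angle in `[0, π]`. -/
noncomputable def angleDensity (α β θ : ℝ) : ℝ :=
  if α - β ≤ θ ∧ θ ≤ α + β ∧ θ + (α + β) < 2 * Real.pi then
    Real.pi * Real.sin α * Real.sin β / Real.sin θ else 0

/-- The density of `μ_α ⋆ μ_β` with respect to `vol`. -/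
noncomputable def convDensity (α β : ℝ) (x : SU2) : ℝ :=
  angleDensity α β (Real.arccos (halfTrace x))

lemma measurable_angleDensity (α β : ℝ) : Measurable (angleDensity α β) := by
  unfold angleDensity
  refine Measurable.ite ?_ (by fun_prop) measurable_const
  exact (measurableSet_le measurable_const measurable_id).inter
    ((measurableSet_le measurable_id measurable_const).inter
      (measurableSet_lt (measurable_id.add_const _) measurable_const))

lemma measurable_convDensity (α β : ℝ) : Measurable (convDensity α β) :=
  (measurable_angleDensity α β).comp (Real.continuous_arccos.measurable.comp measurable_halfTrace)

lemma convDensity_conj (α β : ℝ) (g x : SU2) :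
    convDensity α β (g * x * g⁻¹) = convDensity α β x := by
  rw [convDensity, halfTrace_conj, convDensity]

lemma angleDensity_nonneg {α β θ : ℝ} (hα : 0 ≤ Real.sin α) (hβ : 0 ≤ Real.sin β)
    (hθ : 0 ≤ Real.sin θ) : 0 ≤ angleDensity α β θ := by
  unfold angleDensity
  split_ifs
  · have := Real.pi_pos; positivity
  · exact le_rfl

lemma convDensity_nonneg {α β : ℝ} (hα : 0 ≤ Real.sin α) (hβ : 0 ≤ Real.sin β) (x : SU2) :
    0 ≤ convDensity α β x :=
  angleDensity_nonneg hα hβ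
    (Real.sin_nonneg_of_nonneg_of_le_pi (Real.arccos_nonneg _) (Real.arccos_le_pi _))

/-- The Weyl weight removes the pole of 1 / sin θ; where the sine vanishes both sides are 0. -/
lemma sin_sq_mul_angleDensity (α β θ : ℝ) :
    Real.sin θ ^ 2 * angleDensity α β θ =
      if α - β ≤ θ ∧ θ ≤ α + β ∧ θ + (α + β) < 2 * Real.pi then
        Real.pi * Real.sin α * Real.sin β * Real.sin θ else 0 := by
  unfold angleDensity
  split_ifs
  · by_cases h : Real.sin θ = 0
    · simp [h]
    · field_simp
  · simp

lemma integrable_convDensity (α β : ℝ) : Integrable (convDensity α β) vol := by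
  rw [vol_eq]
  refine Integrable.smul_measure ?_ ENNReal.ofReal_ne_top
  have hk : Measurable fun c => angleDensity α β (Real.arccos c) :=
    (measurable_angleDensity α β).comp Real.continuous_arccos.measurable
  have hc := Real.continuous_cos.measurable
  suffices h : Integrable (fun θ => angleDensity α β (Real.arccos (Real.cos θ))) angleMeasure by
    have h2 := (integrable_map_measure (f := Real.cos) hk.aestronglyMeasurable hc.aemeasurable).mpr h
    rw [← map_halfTrace_haar] at h2
    exact (integrable_map_measure hk.aestronglyMeasurable measurable_halfTrace.aemeasurable).mp h2
  rw [angleMeasure, integrable_withDensity_iff_integrable_smul' (by fun_prop) (by simp)]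
  refine Integrable.of_bound (C := 2 * |Real.sin α * Real.sin β|) ?_ ?_
  · refine Measurable.aestronglyMeasurable ?_
    exact Measurable.smul (f := fun θ => (ENNReal.ofReal (2 / Real.pi * Real.sin θ ^ 2)).toReal)
      (by fun_prop) (hk.comp hc)
  · refine (ae_restrict_mem measurableSet_Icc).mono fun θ hθ => ?_
    rw [Real.arccos_cos hθ.1 hθ.2, ENNReal.toReal_ofReal (by have := Real.pi_pos; positivity),
      smul_eq_mul, mul_assoc, sin_sq_mul_angleDensity]
    split_ifs
    · rw [show 2 / Real.pi * (Real.pi * Real.sin α * Real.sin β * Real.sin θ) =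
        2 * (Real.sin α * Real.sin β) * Real.sin θ by field_simp, Real.norm_eq_abs, abs_mul, abs_mul,
        abs_two]
      exact mul_le_of_le_one_right (by positivity) (Real.abs_sin_le_one θ)
    · rw [mul_zero, norm_zero]
      positivity

lemma integral_mul_convDensity {α β : ℝ} (hβ : 0 < β) (hβα : β ≤ α) (hα : α < Real.pi)
    {F : ℝ → ℝ} (hF : Continuous F) :
    ∫ x, convDensity α β x * F (halfTrace x) ∂vol =
      8 * Real.pi ^ 2 * Real.sin α * Real.sin β *
        ∫ t in Real.cos (α + β)..Real.cos (α - β), F t := by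
  have hpi := Real.pi_pos
  have hk : Measurable fun c => angleDensity α β (Real.arccos c) * F c :=
    ((measurable_angleDensity α β).comp Real.continuous_arccos.measurable).mul hF.measurable
  -- γ is α + β folded into [0, π]: either α + β itself or 2π - (α + β).
  have hcos : ∃ γ, Real.cos γ = Real.cos (α + β) ∧ α - β ≤ γ ∧ γ ≤ Real.pi ∧
      (∀ θ < γ, θ ≤ α + β ∧ θ + (α + β) < 2 * Real.pi) ∧
      (∀ θ, γ < θ → ¬ (θ ≤ α + β ∧ θ + (α + β) < 2 * Real.pi)) := by
    by_cases h : α + β ≤ Real.pi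
    · exact ⟨α + β, rfl, by linarith, h, fun θ hθ => ⟨hθ.le, by linarith⟩,
        fun θ hθ hh => by linarith [hh.1]⟩
    · refine ⟨2 * Real.pi - (α + β), Real.cos_two_pi_sub _, by linarith, by linarith,
        fun θ hθ => ⟨by linarith, by linarith⟩, fun θ hθ hh => by linarith [hh.2]⟩
  obtain ⟨γ, hγc, hγ1, hγ2, hγ3, hγ4⟩ := hcos
  rw [vol_eq, integral_smul_measure, ENNReal.toReal_ofReal (by positivity), smul_eq_mul]
  simp only [convDensity]
  rw [integral_comp_halfTrace_haar (f := fun c => angleDensity α β (Real.arccos c) * F c) hk,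
    ← hγc, integral_cos_substitution hF, intervalIntegral.integral_of_le hγ1,
    ← integral_indicator measurableSet_Icc, ← integral_indicator measurableSet_Ioc,
    ← integral_const_mul, ← integral_const_mul]
  -- Discarding the two endpoints makes strict and weak inequalities interchangeable.
  have hne : ∀ a : ℝ, ∀ᵐ θ : ℝ, θ ≠ a := fun a => Measure.ae_ne volume a
  refine integral_congr_ae ?_
  filter_upwards [hne (α - β), hne γ] with θ h1 h2
  by_cases hθ : θ ∈ Icc 0 Real.pi
  · rw [indicator_of_mem hθ, Real.arccos_cos hθ.1 hθ.2]
    have e : 4 * Real.pi ^ 2 * (2 / Real.pi * Real.sin θ ^ 2 * (angleDensity α β θ *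
        F (Real.cos θ))) = 8 * Real.pi * (Real.sin θ ^ 2 * angleDensity α β θ) * F (Real.cos θ) := by
      field_simp; ring
    rw [e, sin_sq_mul_angleDensity]
    by_cases hS : θ ∈ Ioc (α - β) γ
    · rw [indicator_of_mem hS, if_pos ⟨hS.1.le, hγ3 θ (lt_of_le_of_ne hS.2 h2)⟩]
      ring
    · rw [indicator_of_notMem hS, if_neg]
      · simp
      · rintro ⟨h3, h4⟩
        refine hS ⟨lt_of_le_of_ne h3 h1.symm, ?_⟩
        by_contra h5
        exact hγ4 θ (not_le.mp h5) h4
  · rw [indicator_of_notMem hθ, indicator_of_notMem, mul_zero, mul_zero]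
    intro hS
    exact hθ ⟨by linarith [hS.1], hS.2.trans hγ2⟩

lemma map_conj_vol (k : SU2) : Measure.map (fun x => k * x * k⁻¹) vol = vol := by
  rw [vol_eq, Measure.map_smul, map_conj_haar]

lemma map_conj_withDensity {f : SU2 → ENNReal} (hf : Measurable f)
    (hc : ∀ g x, f (g * x * g⁻¹) = f x) (k : SU2) :
    Measure.map (fun x => k * x * k⁻¹) (vol.withDensity f) = vol.withDensity f := by
  have hk := measurable_conj_apply k
  ext A hA
  rw [Measure.map_apply hk hA, withDensity_apply _ hA, withDensity_apply _ (hk hA)]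
  conv_rhs => rw [← map_conj_vol k, setLIntegral_map hA hf hk]
  simp only [hc]

lemma mconv_eq_withDensity {α β : ℝ} (hβ : 0 < β) (hβα : β ≤ α) (hα : α < Real.pi) :
    Measure.mconv (classMeasure α) (classMeasure β) =
      vol.withDensity fun x => ENNReal.ofReal (convDensity α β x) := by
  have hsα : 0 < Real.sin α := Real.sin_pos_of_pos_of_lt_pi (by linarith) hα
  have hsβ : 0 < Real.sin β := Real.sin_pos_of_pos_of_lt_pi hβ (by linarith)
  have hm : Measurable fun x => ENNReal.ofReal (convDensity α β x) :=
    (measurable_convDensity α β).ennreal_ofReal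
  have hfin : IsFiniteMeasure (vol.withDensity fun x => ENNReal.ofReal (convDensity α β x)) :=
    isFiniteMeasure_withDensity_ofReal (integrable_convDensity α β).hasFiniteIntegral
  have hfin' : IsFiniteMeasure (Measure.mconv (classMeasure α) (classMeasure β)) := by
    unfold Measure.mconv; infer_instance
  refine eq_of_map_halfTrace_eq (map_conj_mconv α β)
    (map_conj_withDensity hm fun g x => by rw [convDensity_conj]) ?_
  refine ext_of_forall_integral_eq_of_IsFiniteMeasure fun F => ?_
  have hF := F.continuous
  rw [integral_map measurable_halfTrace.aemeasurable hF.aestronglyMeasurable,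
    integral_map measurable_halfTrace.aemeasurable hF.aestronglyMeasurable,
    integral_comp_halfTrace_mconv hsα hsβ hF, ← integral_mul_convDensity hβ hβα hα hF,
    integral_withDensity_eq_integral_toReal_smul hm (by simp)]
  refine integral_congr_ae (Filter.Eventually.of_forall fun x => ?_)
  simp only [smul_eq_mul]
  rw [ENNReal.toReal_ofReal (convDensity_nonneg hsα.le hsβ.le x)]

/-- The part of `productDensity` supported on positive angles. -/
noncomputable def halfDensity (α β : ℝ) : ℝ → ℝ :=
  indicator (Icc (α - β) (α + β)) fun θ => 4 * Real.pi ^ 2 * Real.sin α * Real.sin β * Real.sin θ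

/-- The two intervals can meet only at 0, when α = β, and there the sine vanishes. -/
lemma productDensity_eq {α β : ℝ} (hβα : β ≤ α) (θ : ℝ) :
    productDensity α β θ = halfDensity α β θ + halfDensity α β (-θ) := by
  have hiff : -θ ∈ Icc (α - β) (α + β) ↔ -α - β ≤ θ ∧ θ ≤ -α + β := by
    constructor
    · rintro ⟨h1, h2⟩; constructor <;> linarith
    · rintro ⟨h1, h2⟩; constructor <;> linarith
  unfold productDensity halfDensity
  by_cases h1 : θ ∈ Icc (α - β) (α + β)
  · rw [if_pos (show α - β ≤ θ ∧ θ ≤ α + β from h1), indicator_of_mem h1]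
    by_cases h2 : -θ ∈ Icc (α - β) (α + β)
    · have : θ = 0 := by linarith [h1.1, h2.1]
      subst this
      simp [indicator]
    · rw [indicator_of_notMem h2, add_zero]
  · rw [if_neg (show ¬(α - β ≤ θ ∧ θ ≤ α + β) from h1), indicator_of_notMem h1, zero_add]
    by_cases h2 : -θ ∈ Icc (α - β) (α + β)
    · rw [if_pos (hiff.mp h2), indicator_of_mem h2, Real.sin_neg]; ring
    · rw [if_neg (mt hiff.mpr h2), indicator_of_notMem h2]

lemma productDensity_neg {α β : ℝ} (hβα : β ≤ α) (θ : ℝ) :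
    productDensity α β (-θ) = productDensity α β θ := by
  rw [productDensity_eq hβα, productDensity_eq hβα, neg_neg, add_comm]

lemma halfDensity_of_lt {α β θ : ℝ} (h : θ < α - β) : halfDensity α β θ = 0 :=
  indicator_of_notMem (fun hh => not_le.mpr h hh.1) _

lemma halfDensity_of_gt {α β θ : ℝ} (h : α + β < θ) : halfDensity α β θ = 0 :=
  indicator_of_notMem (fun hh => not_le.mpr h hh.2) _

lemma halfDensity_neg {α β θ : ℝ} (hβα : β ≤ α) (h : 0 ≤ θ) : halfDensity α β (-θ) = 0 := by
  rcases h.eq_or_lt with rfl | h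
  · unfold halfDensity
    by_cases h0 : (0 : ℝ) ∈ Icc (α - β) (α + β) <;> simp [indicator]
  · exact halfDensity_of_lt (by linarith)

/-- Where θ and 2π - θ both lie in [α-β, α+β], the two terms cancel because the sine changes sign.
This happens exactly for θ in that interval with θ + (α + β) ≥ 2π, whence the strict inequality in
`angleDensity`. -/
lemma four_pi_mul_sin_sq_mul_angleDensity {α β θ : ℝ} (hβ : 0 < β) (hα : α < Real.pi)
    (hθ : θ ∈ Icc 0 Real.pi) :
    4 * Real.pi * Real.sin θ ^ 2 * angleDensity α β θ =
      halfDensity α β θ + halfDensity α β (2 * Real.pi - θ) := by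
  obtain ⟨h0, h1⟩ := hθ
  rw [mul_assoc, sin_sq_mul_angleDensity]
  have hs : Real.sin (2 * Real.pi - θ) = -Real.sin θ := Real.sin_two_pi_sub θ
  unfold halfDensity
  simp only [indicator, hs, mem_Icc]
  split_ifs with a b c c b c c
  all_goals first
    | (exfalso; grind)
    | ring

lemma hasSum_productDensity_of_mem_Icc {α β θ : ℝ} (hβ : 0 < β) (hβα : β ≤ α) (hα : α < Real.pi)
    (hθ : θ ∈ Icc 0 Real.pi) :
    HasSum (fun k : ℤ => productDensity α β (θ + 2 * Real.pi * k))
      (4 * Real.pi * Real.sin θ ^ 2 * angleDensity α β (Real.arccos (Real.cos θ))) := by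
  have hpi := Real.pi_pos
  obtain ⟨h0, h1⟩ := hθ
  rw [Real.arccos_cos h0 h1, four_pi_mul_sin_sq_mul_angleDensity hβ hα ⟨h0, h1⟩]
  -- For θ ∈ [0, π] and α + β < 2π only the translates k = 0 and k = -1 can meet the support.
  have hsum := hasSum_sum_of_ne_finset_zero (s := {0, -1})
    (f := fun k : ℤ => productDensity α β (θ + 2 * Real.pi * k)) (L := .unconditional ℤ) ?_
  · convert! hsum using 1
    rw [Finset.sum_pair (by norm_num)]
    rw [productDensity_eq hβα, productDensity_eq hβα]
    simp only [Int.cast_zero, mul_zero, add_zero, Int.cast_neg, Int.cast_one]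
    rw [halfDensity_neg hβα h0, halfDensity_of_lt (θ := θ + 2 * Real.pi * -1) (by linarith)]
    rw [show -(θ + 2 * Real.pi * -1) = 2 * Real.pi - θ by ring]
    ring
  · intro k hk
    simp only [Finset.mem_insert, Finset.mem_singleton, not_or] at hk
    rw [productDensity_eq hβα]
    rcases lt_or_gt_of_ne hk.1 with hk0 | hk0
    · have : k ≤ -2 := by omega
      have hk' : (k : ℝ) ≤ -2 := by exact_mod_cast this
      rw [halfDensity_of_lt (by nlinarith), halfDensity_of_gt (by nlinarith), add_zero]
    · have hk' : (1 : ℝ) ≤ k := by exact_mod_cast hk0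
      rw [halfDensity_of_gt (by nlinarith), halfDensity_of_lt (by nlinarith), add_zero]

lemma hasSum_productDensity {α β : ℝ} (hβ : 0 < β) (hβα : β ≤ α) (hα : α < Real.pi) (θ : ℝ) :
    HasSum (fun k : ℤ => productDensity α β (θ + 2 * Real.pi * k))
      (4 * Real.pi * Real.sin θ ^ 2 * angleDensity α β (Real.arccos (Real.cos θ))) := by
  have hpi := Real.pi_pos
  have hsymm : ∀ θ ∈ Icc (-Real.pi) Real.pi,
      HasSum (fun k : ℤ => productDensity α β (θ + 2 * Real.pi * k))
        (4 * Real.pi * Real.sin θ ^ 2 * angleDensity α β (Real.arccos (Real.cos θ))) := by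
    intro θ hθ
    rcases le_total 0 θ with h | h
    · exact hasSum_productDensity_of_mem_Icc hβ hβα hα ⟨h, hθ.2⟩
    · have := hasSum_productDensity_of_mem_Icc (θ := -θ) hβ hβα hα
        ⟨by linarith, by linarith [hθ.1]⟩
      rw [Real.sin_neg, Real.cos_neg, neg_sq, ← (Equiv.neg ℤ).hasSum_iff] at this
      convert! this using 1
      ext1 k
      rw [← productDensity_neg hβα]
      simp only [Function.comp, Equiv.neg_apply, Int.cast_neg]
      congr 1
      ring
  -- Both sides are 2π-periodic: shifting θ by a period only reindexes the sum over k.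
  obtain ⟨n, hn, -⟩ := existsUnique_sub_zsmul_mem_Ioc Real.two_pi_pos θ (-Real.pi)
  rw [zsmul_eq_mul] at hn
  have h := hsymm (θ - n * (2 * Real.pi)) ⟨hn.1.le, by linarith [hn.2]⟩
  rw [Real.sin_sub_int_mul_two_pi, Real.cos_sub_int_mul_two_pi,
    ← (Equiv.addRight n).hasSum_iff] at h
  convert! h using 1
  ext1 k
  simp only [Function.comp, Equiv.coe_addRight, Int.cast_add]
  congr 1
  ring

lemma productDensity_of_add_le_pi {α β : ℝ} (hβ : 0 < β) (hβα : β ≤ α) (hα : α < Real.pi)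
    (h : α + β ≤ Real.pi) {θ : ℝ} (hθ : θ ∈ Icc (-Real.pi) Real.pi) :
    4 * Real.pi * Real.sin θ ^ 2 * angleDensity α β (Real.arccos (Real.cos θ)) =
      productDensity α β θ := by
  have key : ∀ θ ∈ Icc 0 Real.pi,
      4 * Real.pi * Real.sin θ ^ 2 * angleDensity α β (Real.arccos (Real.cos θ)) =
        productDensity α β θ := by
    intro θ hθ
    rw [Real.arccos_cos hθ.1 hθ.2, four_pi_mul_sin_sq_mul_angleDensity hβ hα hθ,
      productDensity_eq hβα, halfDensity_neg hβα hθ.1]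
    congr 1
    -- At θ = π the point 2π - θ may still lie in the interval, but the sine is zero there.
    rcases hθ.2.eq_or_lt with rfl | hlt
    · rw [show 2 * Real.pi - Real.pi = Real.pi by ring]
      simp [halfDensity, indicator]
    · exact halfDensity_of_gt (by linarith)
  rcases le_total 0 θ with h0 | h0
  · exact key θ ⟨h0, hθ.2⟩
  · have := key (-θ) ⟨by linarith, by linarith [hθ.1]⟩
    rwa [Real.sin_neg, Real.cos_neg, neg_sq, productDensity_neg hβα] at this

/-- No folding is needed: t = cos θ is substituted on all of [α-β, α+β], and the reflected half of f
doubles 4π² to 8π². -/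
lemma integral_mconv_classFunction {α β : ℝ} (hβ : 0 < β) (hβα : β ≤ α) (hα : α < Real.pi)
    {φ : SU2 → ℝ} (hφ : Continuous φ) (hc : ∀ g x, φ (g * x * g⁻¹) = φ x) :
    ∫ x, φ x ∂(Measure.mconv (classMeasure α) (classMeasure β)) =
      ∫ θ : ℝ, φ (torus θ) * productDensity α β θ := by
  have hsα : 0 < Real.sin α := Real.sin_pos_of_pos_of_lt_pi (by linarith) hα
  have hsβ : 0 < Real.sin β := Real.sin_pos_of_pos_of_lt_pi hβ (by linarith)
  set F : ℝ → ℝ := fun c => φ (torus (Real.arccos c)) with hFdef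
  have hF : Continuous F := hφ.comp (continuous_torus.comp Real.continuous_arccos)
  have hφF : ∀ x, φ x = F (halfTrace x) := fun x => classFunction_eq φ hc (by
    rw [halfTrace_torus, Real.cos_arccos (halfTrace_mem_Icc x).1 (halfTrace_mem_Icc x).2])
  have hφt : ∀ θ, φ (torus θ) = F (Real.cos θ) := fun θ => by rw [hφF, halfTrace_torus]
  set G : ℝ → ℝ := fun θ => F (Real.cos θ) * halfDensity α β θ with hG
  have hGeq : G = indicator (Icc (α - β) (α + β)) fun θ =>
      4 * Real.pi ^ 2 * Real.sin α * Real.sin β * (F (Real.cos θ) * Real.sin θ) := by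
    ext θ
    simp only [hG, halfDensity, indicator]
    split_ifs
    · ring
    · simp
  have hGi : Integrable G := by
    rw [hGeq, integrable_indicator_iff measurableSet_Icc]
    exact Continuous.integrableOn_Icc (by fun_prop)
  have hGint : ∫ θ, G θ = 4 * Real.pi ^ 2 * Real.sin α * Real.sin β *
      ∫ t in Real.cos (α + β)..Real.cos (α - β), F t := by
    rw [hGeq, integral_indicator measurableSet_Icc, integral_const_mul,
      integral_Icc_eq_integral_Ioc, integral_cos_substitution hF,
      intervalIntegral.integral_of_le (by linarith)]
  have hsplit : ∀ θ, φ (torus θ) * productDensity α β θ = G θ + G (-θ) := by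
    intro θ
    simp only [hG]
    rw [hφt, productDensity_eq hβα, Real.cos_neg]
    ring
  simp only [hsplit]
  rw [integral_add hGi hGi.comp_neg, integral_neg_eq_self G volume, hGint]
  simp only [hφF]
  rw [integral_comp_halfTrace_mconv hsα hsβ hF]
  ring

end

end SU2Conv

theorem theorem1 (α β : ℝ) (hβ : 0 < β) (hβα : β ≤ α) (hα : α < Real.pi) :
    -- absolute continuity of the convolution
    (Measure.mconv (SU2Conv.classMeasure α) (SU2Conv.classMeasure β)) ≪ SU2Conv.vol ∧
    -- conjugation invariance of the convolution
    (∀ g : SU2Conv.SU2,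
      Measure.map (fun x => g * x * g⁻¹)
        (Measure.mconv (SU2Conv.classMeasure α) (SU2Conv.classMeasure β)) =
      Measure.mconv (SU2Conv.classMeasure α) (SU2Conv.classMeasure β)) ∧
    -- it has a density, which is a class function, given on the torus by the formula
    (∃ h : SU2Conv.SU2 → ℝ,
      Measurable h ∧ (∀ x, 0 ≤ h x) ∧ Integrable h SU2Conv.vol ∧
      (∀ g x, h (g * x * g⁻¹) = h x) ∧
      Measure.mconv (SU2Conv.classMeasure α) (SU2Conv.classMeasure β) =
        SU2Conv.vol.withDensity (fun x => ENNReal.ofReal (h x)) ∧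
      (∀ θ : ℝ, SU2Conv.torusDensity h θ =
        4 * Real.pi * Real.sin θ ^ 2 * h (SU2Conv.torus θ)) ∧
      -- as a function on the circle `ℝ / 2πℤ`
      (∀ θ : ℝ, HasSum (fun k : ℤ => SU2Conv.productDensity α β (θ + 2 * Real.pi * k))
        (SU2Conv.torusDensity h θ)) ∧
      -- literally on `[-π, π]`, when the intervals do not wrap around the circle
      (α + β ≤ Real.pi → ∀ θ ∈ Set.Icc (-Real.pi) Real.pi,
        SU2Conv.torusDensity h θ = SU2Conv.productDensity α β θ)) ∧
    -- integration of class functions against the convolution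
    (∀ φ : SU2Conv.SU2 → ℝ, Continuous φ → (∀ g x, φ (g * x * g⁻¹) = φ x) →
      ∫ x, φ x ∂(Measure.mconv (SU2Conv.classMeasure α) (SU2Conv.classMeasure β)) =
        ∫ θ : ℝ, φ (SU2Conv.torus θ) * SU2Conv.productDensity α β θ) := by
  refine ⟨?_, SU2Conv.map_conj_mconv α β, ⟨SU2Conv.convDensity α β,
    SU2Conv.measurable_convDensity α β, SU2Conv.convDensity_nonneg ?_ ?_,
    SU2Conv.integrable_convDensity α β, SU2Conv.convDensity_conj α β,
    SU2Conv.mconv_eq_withDensity hβ hβα hα,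
    SU2Conv.torusDensity_of_classFunction (SU2Conv.measurable_convDensity α β)
      (SU2Conv.convDensity_conj α β), fun θ => ?_, fun h θ hθ => ?_⟩,
    fun φ hφ hc => SU2Conv.integral_mconv_classFunction hβ hβα hα hφ hc⟩
  · rw [SU2Conv.mconv_eq_withDensity hβ hβα hα]
    exact withDensity_absolutelyContinuous _ _
  · exact Real.sin_nonneg_of_nonneg_of_le_pi (by linarith) hα.le
  · exact Real.sin_nonneg_of_nonneg_of_le_pi hβ.le (by linarith)
  · rw [SU2Conv.torusDensity_of_classFunction (SU2Conv.measurable_convDensity α β)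
      (SU2Conv.convDensity_conj α β), SU2Conv.convDensity, SU2Conv.halfTrace_torus]
    exact SU2Conv.hasSum_productDensity hβ hβα hα θ
  · rw [SU2Conv.torusDensity_of_classFunction (SU2Conv.measurable_convDensity α β)
      (SU2Conv.convDensity_conj α β), SU2Conv.convDensity, SU2Conv.halfTrace_torus]
    exact SU2Conv.productDensity_of_add_le_pi hβ hβα hα h hθ
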